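/- Fix a principal ideal domain $R$ of coefficients. A higher-dimensional automaton (HDA) $\mathcal A$ over a concurrent alphabet $(\Sigma,D)$ (a set $\Sigma$ with a reflexive and symmetric relation $D$) consists of a precubical set $P_{\mathcal A}$ with boundary operators $d^k_i\colon (P_{\mathcal A})_n\to (P_{\mathcal A})_{n-1}$ ($k\in\{0,1\}$, $1\le i\le n$), an initial state $I_{\mathcal A}\in (P_{\mathcal A})_0$, a set of final states $F_{\mathcal A}\subseteq (P_{\mathcal A})_0$, and a labeling $\lambda_{\mathcal A}\colon (P_{\mathcal A})_1\to\Sigma^*$ such that for every 2-cube $z$ one has $\lambda_{\mathcal A}(d^0_iz)=\lambda_{\mathcal A}(d^1_iz)$ ($i=1,2$), and for all $(a,b)\in D$ the word $\lambda_{\mathcal A}(d^0_1z)$ does not contain $a$ or $\lambda_{\mathcal A}(d^0_2z)$ does not contain $b$. For $y\in (P_{\mathcal A})_n$, let $y_\sharp\colon [\![0,1]\!]^{\otimes n}\to P_{\mathcal A}$ be the unique morphism of precubical sets from the precubical $n$-cube that sends its top cell to $y$; $y$ is regular if $y_\sharp$ is injective. The star of a vertex $v$ consists of all $y$ (of any degree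 $n$) with $v\in y_\sharp([\![0,1]\!]^{\otimes n})$. Two HDAs $\mathcal A$, $\mathcal B$ over the same concurrent alphabet are weakly equivalent, $\mathcal A\simeq\mathcal B$, if 1. $\mathcal A$ is accessible (every vertex is the end of a path from the initial state) if and only if $\mathcal B$ is, and $\mathcal A$ is coaccessible (from every vertex there is a path to a final state) if and only if $\mathcal B$ is; 2. $\pi(\mathcal A)=\pi(\mathcal B)$ and $TL(\mathcal A)=TL(\mathcal B)$, where, in the trace monoid of $(\Sigma,D)$ (the quotient of $\Sigma^*$ by the congruence generated by $ab\equiv ba$ for $(a,b)\notin D$), $\pi$ is the set of classes of labels of loops at the initial state and $TL$ is the set of prefixes of classes of labels of paths starting at the initial state; 3. $HL(\mathcal A)=HL(\mathcal B)$, where $HL(\mathcal A)$ is the graded image of the map $H_*(P_{\mathcal A};R)\to\Lambda_R(\Sigma)$ from cubical homology to the exterior algebra on the free $R$-module generated by $\Sigma$ that is induced by $y\mapsto \sum_{j_1,\dots,j_n}\lambda_{\mathcal A}(e_1y)_{j_1}\wedge\dots\wedge\lambda_{\mathcal A}(e_ny)_{j_n}$ for $y$ of degree $n$ (so $y\mapsto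 1$ for $n=0$). Here $w_j$ is the $j$th letter of a word $w$, and $e_iy=d^0_1\cdots d^0_{i-1}d^0_{i+1}\cdots d^0_ny$. **Theorem.** Let $x$ be a regular cube of degree $n\ge 2$ of an HDA $\mathcal A$, and let $k_1,\dots,k_n\in\{0,1\}$ be such that at least one $k_i=0$ and at least one $k_i=1$. Put $v=d^{k_n}_1\cdots d^{k_1}_1x$. Suppose that $v\notin\{I_{\mathcal A}\}\cup F_{\mathcal A}$ and that $\mathrm{star}(v)\subseteq x_\sharp([\![0,1]\!]^{\otimes n})$. Let $\mathcal B\subseteq\mathcal A$ be the sub-HDA with $P_{\mathcal B}=P_{\mathcal A}\setminus\mathrm{star}(v)$, over the same concurrent alphabet, with $I_{\mathcal B}=I_{\mathcal A}$, $F_{\mathcal B}=F_{\mathcal A}\cap (P_{\mathcal B})_0$ and $\lambda_{\mathcal B}$ the restriction of $\lambda_{\mathcal A}$. Then $\mathcal A\simeq\mathcal B$. -/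

import Mathlib

universe u v w

noncomputable section

/-! ## Subquotients of modules -/

section Subquotient

variable {R : Type w} [CommRing R] {M : Type u} [AddCommGroup M] [Module R M]
  {N : Type v} [AddCommGroup N] [Module R N]

/-- The quotient of `Z` by its submodule `B ∩ Z` (which is `B` itself if `B ≤ Z`, as for boundaries and cycles). -/
abbrev Subquotient (Z B : Submodule R M) := Z ⧸ B.submoduleOf Z

/-- The linear map `[z] ↦ f z` induced by a linear map that vanishes on `B`. -/
def Subquotient.lift (Z B : Submodule R M) (f : M →ₗ[R] N) (h : B ≤ LinearMap.ker f) :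
    Subquotient Z B →ₗ[R] N :=
  Submodule.liftQ _ (f ∘ₗ Z.subtype) fun _ hz => h hz

end Subquotient

/-! ## Precubical sets -/

/-- A precubical set. Indices are shifted by one: `face k i` with `i : Fin (n + 1)` is the
boundary operator `d^k_{i+1}` from degree `n + 1` to degree `n`. -/
structure PrecubicalSet where
  cube : ℕ → Type u
  face : Fin 2 → {n : ℕ} → Fin (n + 1) → cube (n + 1) → cube n
  face_face : ∀ (k l : Fin 2) {n : ℕ} (i j : Fin (n + 1)), i ≤ j → ∀ x : cube (n + 2),
    face k i (face l j.succ x) = face l j (face k i.castSucc x)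

namespace PrecubicalSet

/-- Morphisms of precubical sets. -/
structure Hom (P : PrecubicalSet.{u}) (Q : PrecubicalSet.{v}) where
  app : ∀ n : ℕ, P.cube n → Q.cube n
  app_face : ∀ (k : Fin 2) {n : ℕ} (i : Fin (n + 1)) (x : P.cube (n + 1)),
    app n (P.face k i x) = Q.face k i (app (n + 1) x)

/-- A precubical subset: a graded subset stable under the boundary operators. -/
structure Subset (P : PrecubicalSet.{u}) where
  carrier : ∀ n : ℕ, Set (P.cube n)
  face_mem : ∀ (k : Fin 2) {n : ℕ} (i : Fin (n + 1)) (x : P.cube (n + 1)),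
    x ∈ carrier (n + 1) → P.face k i x ∈ carrier n

/-- A precubical subset, regarded as a precubical set. -/
def Subset.toPrecubicalSet {P : PrecubicalSet.{u}} (Q : P.Subset) : PrecubicalSet.{u} where
  cube n := Q.carrier n
  face k _ i x := ⟨P.face k i x.1, Q.face_mem k i x.1 x.2⟩
  face_face k l _ i j h x := Subtype.ext (P.face_face k l i j h x.1)

/-! ## The precubical cubes `⟦0,1⟧^{⊗n}` -/

/-- `CubeCell n m` is the set of elements of degree `m` of the `n`-fold tensor power of the
precubical interval `⟦0,1⟧`, that is, of sequences `(c₁, …, cₙ)` with entries in `{0, 1, [0,1]}`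
of which exactly `m` are equal to `[0,1]`. -/
inductive CubeCell : ℕ → ℕ → Type
  /-- the unique element of `⟦0,1⟧^{⊗0}` -/
  | nil : CubeCell 0 0
  /-- the element `(k, c)` with `k` a vertex of `⟦0,1⟧` -/
  | vert {n m : ℕ} (k : Fin 2) (c : CubeCell n m) : CubeCell (n + 1) m
  /-- the element `([0,1], c)` -/
  | edge {n m : ℕ} (c : CubeCell n m) : CubeCell (n + 1) (m + 1)

/-- Boundary operators of the tensor power: `d^k_1 ([0,1], c) = (k, c)`,
`d^k_{i+1} ([0,1], c) = ([0,1], d^k_i c)`, and `d^k_i (l, c) = (l, d^k_i c)`. -/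
def CubeCell.face (k : Fin 2) : {n m : ℕ} → CubeCell n (m + 1) → Fin (m + 1) → CubeCell n m
  | _, _, .vert l c, i => .vert l (c.face k i)
  | _, 0, .edge c, _ => .vert k c
  | _, _ + 1, .edge c, i => Fin.cases (.vert k c) (fun j => .edge (c.face k j)) i

theorem CubeCell.face_face (k l : Fin 2) {n m : ℕ} (c : CubeCell n (m + 2)) :
    ∀ i j : Fin (m + 1), i ≤ j →
      (c.face l j.succ).face k i = (c.face k i.castSucc).face l j := by
  induction n generalizing m with
  | zero => cases c
  | succ n ih =>
    intro i j hij
    cases c with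
    | vert q c => simp only [CubeCell.face, ih c i j hij]
    | edge c =>
      cases m with
      | zero =>
        obtain rfl := Fin.fin_one_eq_zero i
        obtain rfl := Fin.fin_one_eq_zero j
        rfl
      | succ m =>
        cases i using Fin.cases with
        | zero => rfl
        | succ i =>
          cases j using Fin.cases with
          | zero => simp at hij
          | succ j =>
            simp only [CubeCell.face, Fin.cases_succ, Fin.castSucc_succ,
              ih c i j (by simpa using hij)]

/-- The precubical `n`-cube `⟦0,1⟧^{⊗n}`. -/
def stdCube (n : ℕ) : PrecubicalSet.{0} where
  cube m := CubeCell n m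
  face k _ i c := c.face k i
  face_face k l _ i j h c := c.face_face k l i j h

/-- The unique element `ι_n = ([0,1], …, [0,1])` of degree `n` of `⟦0,1⟧^{⊗n}`. -/
def CubeCell.iota : (n : ℕ) → CubeCell n n
  | 0 => .nil
  | n + 1 => .edge (iota n)

/-- Auxiliary shifted precubical set, with `n`-cubes the `(n + 1)`-cubes of `P` and boundary
operators the `d^k_{i+1}`. -/
def shift (P : PrecubicalSet.{u}) : PrecubicalSet.{u} where
  cube n := P.cube (n + 1)
  face k _ i x := P.face k i.succ x
  face_face k l _ i j h x := by
    have := P.face_face k l i.succ j.succ (by simpa using h) x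
    simpa using this

/-- `P.sharp c x` is the image of the element `c` of `⟦0,1⟧^{⊗n}` under the morphism of
precubical sets `x_♯ : ⟦0,1⟧^{⊗n} → P` with `x_♯(ι_n) = x`. It is characterised by
`existsUnique_hom` below. -/
def sharp : {n m : ℕ} → CubeCell n m → (P : PrecubicalSet.{u}) → P.cube n → P.cube m
  | _, _, .nil, _, x => x
  | _, _, .vert k c, P, x => sharp c P (P.face k 0 x)
  | _, _, .edge c, P, x => sharp c P.shift x

theorem sharp_natural {n m : ℕ} (c : CubeCell n m) :
    ∀ {P : PrecubicalSet.{u}} {Q : PrecubicalSet.{v}} (f : Hom P Q) (x : P.cube n),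
      sharp c Q (f.app n x) = f.app m (sharp c P x) := by
  induction c with
  | nil => intros; rfl
  | vert k c ih => intro P Q f x; simp only [sharp, ← f.app_face, ih f]
  | edge c ih =>
    intro P Q f x
    exact ih (P := P.shift) (Q := Q.shift)
      ⟨fun n => f.app (n + 1), fun k _ i x => f.app_face k i.succ x⟩ x

/-- The boundary operator `d^k_1`, as a morphism from the shifted precubical set. -/
def shiftFace (P : PrecubicalSet.{u}) (k : Fin 2) : Hom P.shift P where
  app _ x := P.face k 0 x
  app_face l _ i x := P.face_face k l 0 i (Fin.zero_le _) x

theorem sharp_face (k : Fin 2) {n m : ℕ} (c : CubeCell n (m + 1)) :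
    ∀ (i : Fin (m + 1)) (P : PrecubicalSet.{u}) (x : P.cube n),
      sharp (c.face k i) P x = P.face k i (sharp c P x) := by
  induction n generalizing m with
  | zero => cases c
  | succ n ih =>
    intro i P x
    cases c with
    | vert q c => exact ih c i P _
    | edge c =>
      cases m with
      | zero =>
        obtain rfl := Fin.fin_one_eq_zero i
        exact sharp_natural c (P.shiftFace k) x
      | succ m =>
        cases i using Fin.cases with
        | zero => exact sharp_natural c (P.shiftFace k) x
        | succ i => exact ih c i P.shift x

/-- The morphism of precubical sets `x_♯ : ⟦0,1⟧^{⊗n} → P` determined by `x ∈ P_n`. -/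
def sharpHom {P : PrecubicalSet.{u}} {n : ℕ} (x : P.cube n) : Hom (stdCube n) P where
  app _ c := sharp c P x
  app_face k _ i c := sharp_face k c i P x

theorem sharp_iota {n : ℕ} : ∀ (P : PrecubicalSet.{u}) (x : P.cube n),
    sharp (CubeCell.iota n) P x = x := by
  induction n with
  | zero => intros; rfl
  | succ n ih => intro P x; exact ih P.shift x

theorem iota_sharp {n m : ℕ} (c : CubeCell n m) :
    sharp c (stdCube n) (CubeCell.iota n) = c := by
  induction c with
  | nil => rfl
  | @vert n m k c ih =>
    have h : ∀ n, (CubeCell.iota (n + 1)).face k 0 = .vert k (CubeCell.iota n) := by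
      intro n; cases n <;> rfl
    refine (congrArg (sharp c (stdCube (n + 1))) (h n)).trans ?_
    exact (sharp_natural c (P := stdCube n) (Q := stdCube (n + 1))
      ⟨fun _ c => .vert k c, fun _ _ _ _ => rfl⟩ (CubeCell.iota n)).trans
      (congrArg (CubeCell.vert k) ih)
  | @edge n m c ih =>
    exact (sharp_natural c (P := stdCube n) (Q := (stdCube (n + 1)).shift)
      ⟨fun _ c => .edge c, fun _ _ _ _ => rfl⟩ (CubeCell.iota n)).trans
      (congrArg CubeCell.edge ih)

/-- `x_♯` is the unique morphism `⟦0,1⟧^{⊗n} → P` that sends `ι_n` to `x`. -/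
theorem existsUnique_hom {P : PrecubicalSet.{u}} {n : ℕ} (x : P.cube n) :
    (sharpHom x).app n (CubeCell.iota n) = x ∧
      ∀ f : Hom (stdCube n) P, f.app n (CubeCell.iota n) = x → f = sharpHom x := by
  refine ⟨sharp_iota P x, ?_⟩
  rintro ⟨g, hg⟩ rfl
  have : g = (sharpHom (g n (CubeCell.iota n))).app := by
    funext m c
    have := sharp_natural c (⟨g, hg⟩ : Hom (stdCube n) P) (CubeCell.iota n)
    rw [iota_sharp c] at this
    exact this.symm
  exact (Hom.mk.injEq ..).mpr this

/-- An element `x` is regular if the morphism `x_♯` is injective. -/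
def IsRegular {P : PrecubicalSet.{u}} {n : ℕ} (x : P.cube n) : Prop :=
  ∀ m : ℕ, Function.Injective ((sharpHom x).app m)

/-- The vertex `d^{k_n}_1 ⋯ d^{k_1}_1 x` of an `n`-cube `x` (`d^{k_1}_1` is applied first;
the index `k_{i+1}` is `k i`). -/
def corner (P : PrecubicalSet.{u}) : {n : ℕ} → (Fin n → Fin 2) → P.cube n → P.cube 0
  | 0, _, x => x
  | _ + 1, k, x => P.corner (fun i => k i.succ) (P.face (k 0) 0 x)

/-- The degree `n` part of the star of `x`: all `y ∈ P_n` with `x ∈ y_♯(⟦0,1⟧^{⊗n})`. -/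
def star {P : PrecubicalSet.{u}} {m : ℕ} (x : P.cube m) (n : ℕ) : Set (P.cube n) :=
  {y | x ∈ Set.range ((sharpHom y).app m)}

/-- The precubical subset `P ∖ star(x)`. -/
def starCompl {P : PrecubicalSet.{u}} {m : ℕ} (x : P.cube m) : P.Subset where
  carrier n := (star x n)ᶜ
  face_mem k n i y hy := by
    rintro ⟨c, hc⟩
    refine hy ⟨sharp c (stdCube (n + 1)) ((CubeCell.iota (n + 1)).face k i), ?_⟩
    have h1 := sharp_natural c (sharpHom y) ((CubeCell.iota (n + 1)).face k i)
    have h2 : (sharpHom y).app n ((CubeCell.iota (n + 1)).face k i) = P.face k i y :=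
      (sharp_face k _ i P y).trans (congrArg _ (sharp_iota P y))
    rw [h2] at h1
    exact h1.symm.trans hc

theorem mem_starCompl_zero {P : PrecubicalSet.{u}} {v q : P.cube 0} (h : v ≠ q) :
    q ∈ (starCompl v).carrier 0 := by
  rintro ⟨c, hc⟩
  cases c
  exact h hc.symm

/-! ## Paths -/

/-- Cells of the precubical interval `⟦0,l⟧`: the vertices `0, …, l` and the edges
`[j, j+1]` for `0 ≤ j < l`. -/
def intervalCube (l : ℕ) : ℕ → Type
  | 0 => Fin (l + 1)
  | 1 => Fin l
  | _ + 2 => Empty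

/-- `d^0_1 [j, j+1] = j` and `d^1_1 [j, j+1] = j + 1`. -/
def intervalFace (l : ℕ) (k : Fin 2) :
    {n : ℕ} → Fin (n + 1) → intervalCube l (n + 1) → intervalCube l n
  | 0, _, j => if k = 0 then Fin.castSucc (n := l) j else Fin.succ (n := l) j
  | _ + 1, _, j => Empty.elim j

/-- The precubical interval `⟦0,l⟧`. -/
def interval (l : ℕ) : PrecubicalSet.{0} where
  cube := intervalCube l
  face k _ i x := intervalFace l k i x
  face_face _ _ _ _ _ _ x := Empty.elim x

/-- Paths of length `l` in `P`. -/
abbrev Path (P : PrecubicalSet.{u}) (l : ℕ) := Hom (interval l) P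

/-- The vertex `ω(j)` of a path. -/
def Path.vertex {P : PrecubicalSet.{u}} {l : ℕ} (ω : P.Path l) (j : Fin (l + 1)) : P.cube 0 :=
  ω.app 0 j

/-- The edge `ω([j, j+1])` of a path. -/
def Path.edge {P : PrecubicalSet.{u}} {l : ℕ} (ω : P.Path l) (j : Fin l) : P.cube 1 :=
  ω.app 1 j

/-- The vertex at which a path starts. -/
def Path.source {P : PrecubicalSet.{u}} {l : ℕ} (ω : P.Path l) : P.cube 0 := ω.vertex 0

/-- The vertex at which a path ends. -/
def Path.target {P : PrecubicalSet.{u}} {l : ℕ} (ω : P.Path l) : P.cube 0 :=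
  ω.vertex (Fin.last l)

/-! ## Cubical chains and cubical homology -/

/-- The boundary operator of the cubical chain complex,
`d x = ∑_{i=1}^{n+1} (-1)^i (d^0_i x - d^1_i x)` for `x` of degree `n + 1`. -/
def chainBoundary (R : Type w) [CommRing R] (P : PrecubicalSet.{u}) (n : ℕ) :
    (P.cube (n + 1) →₀ R) →ₗ[R] (P.cube n →₀ R) :=
  Finsupp.linearCombination R fun x : P.cube (n + 1) =>
    ∑ i : Fin (n + 1), (-1 : R) ^ ((i : ℕ) + 1) •
      (Finsupp.single (P.face 0 i x) (1 : R) - Finsupp.single (P.face 1 i x) (1 : R))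

/-- The module of cubical `n`-cycles; every `0`-chain is a cycle. -/
def chainCycles (R : Type w) [CommRing R] (P : PrecubicalSet.{u}) :
    (n : ℕ) → Submodule R (P.cube n →₀ R)
  | 0 => ⊤
  | n + 1 => LinearMap.ker (P.chainBoundary R n)

/-- The cubical homology `H_n(P)`: cycles modulo boundaries. -/
abbrev Homology (R : Type w) [CommRing R] (P : PrecubicalSet.{u}) (n : ℕ) :=
  Subquotient (P.chainCycles R n) (LinearMap.range (P.chainBoundary R n))

/-- The starting edge `e_i x = d^0_1 ⋯ d^0_{i-1} d^0_{i+1} ⋯ d^0_n x` (with `e_1 x = x` in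
degree `1`). In each step the operator with the highest index is removed: this is `d^0_n`
if `i < n` and `d^0_{n-1}` if `i = n`. -/
def startEdge (P : PrecubicalSet.{u}) : {n : ℕ} → Fin n → P.cube n → P.cube 1
  | 0, i, _ => i.elim0
  | 1, _, x => x
  | n + 2, i, x =>
    Fin.lastCases (motive := fun _ => P.cube 1)
      (P.startEdge (Fin.last n) (P.face 0 (Fin.last n).castSucc x))
      (fun j => P.startEdge j (P.face 0 (Fin.last (n + 1)) x)) i

/-- Boundary operators can be interchanged, with new indices independent of the signs. -/
theorem exists_face_comm (P : PrecubicalSet.{u}) {n : ℕ} (p : Fin (n + 1)) (i : Fin (n + 2)) :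
    ∃ (i' : Fin (n + 1)) (p' : Fin (n + 2)), ∀ (k l : Fin 2) (x : P.cube (n + 2)),
      P.face l p (P.face k i x) = P.face k i' (P.face l p' x) := by
  by_cases h : i ≤ p.castSucc
  · have hi : (i : ℕ) < n + 1 := lt_of_le_of_lt (by simpa [Fin.le_def] using h) p.2
    refine ⟨⟨i, hi⟩, p.succ, fun k l x => ?_⟩
    exact (P.face_face k l ⟨i, hi⟩ p (by simpa [Fin.le_def] using h) x).symm
  · have h0 : i ≠ 0 := by rintro rfl; exact h (Fin.zero_le _)
    obtain ⟨j, rfl⟩ := Fin.exists_succ_eq.2 h0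
    refine ⟨j, p.castSucc, fun k l x => ?_⟩
    refine P.face_face l k p j ?_ x
    simp only [Fin.le_def, Fin.val_succ, Fin.val_castSucc] at h ⊢
    omega

/-- The `j`th starting edges of opposite faces are opposite faces of a 2-cube. -/
theorem exists_startEdge_face (P : PrecubicalSet.{u}) {n : ℕ} (i : Fin (n + 2))
    (j : Fin (n + 1)) : ∀ x : P.cube (n + 2), ∃ (z : P.cube 2) (a : Fin 2),
      ∀ k : Fin 2, P.startEdge j (P.face k i x) = P.face k a z := by
  induction n with
  | zero => exact fun x => ⟨x, i, fun k => by simp only [startEdge]⟩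
  | succ n ih =>
    intro x
    cases j using Fin.lastCases with
    | last =>
      obtain ⟨i', p', h⟩ := P.exists_face_comm (Fin.last n).castSucc i
      obtain ⟨z, a, hz⟩ := ih i' (Fin.last n) (P.face 0 p' x)
      refine ⟨z, a, fun k => ?_⟩
      simp only [startEdge, Fin.lastCases_last, h k 0 x, hz k]
    | cast j =>
      obtain ⟨i', p', h⟩ := P.exists_face_comm (Fin.last (n + 1)) i
      obtain ⟨z, a, hz⟩ := ih i' j (P.face 0 p' x)
      refine ⟨z, a, fun k => ?_⟩
      simp only [startEdge, Fin.lastCases_castSucc, h k 0 x, hz k]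

end PrecubicalSet

/-! ## Concurrent alphabets and trace monoids -/

/-- A concurrent alphabet: an alphabet with a reflexive and symmetric dependence relation. -/
structure ConcurrentAlphabet where
  letter : Type v
  dep : letter → letter → Prop
  dep_refl : ∀ a, dep a a
  dep_symm : ∀ a b, dep a b → dep b a

namespace ConcurrentAlphabet

/-- The smallest congruence on the free monoid with `ab ≡ ba` for all independent `a`, `b`. -/
def traceCon (S : ConcurrentAlphabet.{v}) : Con (FreeMonoid S.letter) :=
  conGen fun x y => ∃ a b : S.letter, ¬ S.dep a b ∧
    x = FreeMonoid.of a * FreeMonoid.of b ∧ y = FreeMonoid.of b * FreeMonoid.of a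

/-- The trace monoid `M(Σ, D)`. -/
abbrev TraceMonoid (S : ConcurrentAlphabet.{v}) := S.traceCon.Quotient

/-- The class `[m]` of a word in the trace monoid. -/
def trace (S : ConcurrentAlphabet.{v}) (m : FreeMonoid S.letter) : S.TraceMonoid :=
  (m : S.traceCon.Quotient)

/-- The sum over all `j₁, …, jₙ` of `(m₁)_{j₁} ∧ ⋯ ∧ (mₙ)_{jₙ}` in the `n`th exterior power
of the free module on the alphabet, for words `m₁, …, mₙ`. It is `1` for `n = 0`. -/
def wedge (R : Type w) [CommRing R] (S : ConcurrentAlphabet.{v}) {n : ℕ}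
    (m : Fin n → FreeMonoid S.letter) : ⋀[R]^n (S.letter →₀ R) :=
  ∑ j : (i : Fin n) → Fin (m i).toList.length,
    exteriorPower.ιMulti R n fun i => Finsupp.single ((m i).toList.get (j i)) (1 : R)

end ConcurrentAlphabet

/-! ## Higher-dimensional automata -/

/-- A higher-dimensional automaton over the concurrent alphabet `S`. -/
structure HDA (S : ConcurrentAlphabet.{v}) where
  /-- the underlying precubical set -/
  cubes : PrecubicalSet.{u}
  /-- the initial state -/
  init : cubes.cube 0
  /-- the set of final states -/
  final : Set (cubes.cube 0)
  /-- the labeling function -/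
  label : cubes.cube 1 → FreeMonoid S.letter
  label_face : ∀ (x : cubes.cube 2) (i : Fin 2),
    label (cubes.face 0 i x) = label (cubes.face 1 i x)
  label_indep : ∀ (x : cubes.cube 2) (a b : S.letter), S.dep a b →
    a ∉ (label (cubes.face 0 0 x)).toList ∨ b ∉ (label (cubes.face 0 1 x)).toList

namespace HDA

open PrecubicalSet

variable {S : ConcurrentAlphabet.{v}}

/-- The sub-HDA of `A` over the same concurrent alphabet whose precubical set is a given
precubical subset `Q` that contains the initial state. -/
def sub (A : HDA.{u, v} S) (Q : A.cubes.Subset) (h : A.init ∈ Q.carrier 0) : HDA.{u, v} S where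
  cubes := Q.toPrecubicalSet
  init := ⟨A.init, h⟩
  final := {x | x.1 ∈ A.final}
  label x := A.label x.1
  label_face x i := A.label_face x.1 i
  label_indep x a b hab := A.label_indep x.1 a b hab

/-- The sub-HDA of `A` over the same concurrent alphabet whose precubical set is the complement
of the star of a vertex `v` different from the initial state. -/
def removeStar (A : HDA.{u, v} S) (v : A.cubes.cube 0) (hv : v ≠ A.init) : HDA.{u, v} S :=
  A.sub (starCompl v) (mem_starCompl_zero hv)

/-- The label of a path: the product of the labels of its edges. -/
def pathLabel (A : HDA.{u, v} S) {l : ℕ} (ω : A.cubes.Path l) : FreeMonoid S.letter :=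
  (List.ofFn fun j : Fin l => A.label (ω.edge j)).prod

/-- The trace language: all prefixes of traces of paths that start in the initial state. -/
def traceLanguage (A : HDA.{u, v} S) : Set S.TraceMonoid :=
  {m | ∃ (l : ℕ) (ω : A.cubes.Path l), ω.source = A.init ∧
    ∃ m' : S.TraceMonoid, S.trace (A.pathLabel ω) = m * m'}

/-- The (underlying set of the) fundamental monoid: the traces of the loops at the initial
state. -/
def fundamentalMonoid (A : HDA.{u, v} S) : Set S.TraceMonoid :=
  {m | ∃ (l : ℕ) (ω : A.cubes.Path l), ω.source = A.init ∧ ω.target = A.init ∧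
    S.trace (A.pathLabel ω) = m}

/-- Every state can be reached from the initial state. -/
def Accessible (A : HDA.{u, v} S) : Prop :=
  ∀ x : A.cubes.cube 0, ∃ (l : ℕ) (ω : A.cubes.Path l), ω.source = A.init ∧ ω.target = x

/-- From every state a final state can be reached. -/
def Coaccessible (A : HDA.{u, v} S) : Prop :=
  ∀ x : A.cubes.cube 0, ∃ (l : ℕ) (ω : A.cubes.Path l), ω.source = x ∧ ω.target ∈ A.final

section Homology

variable (R : Type w) [CommRing R]

/-- The labeling chain map in degree `n`. -/
def labelChain (A : HDA.{u, v} S) (n : ℕ) :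
    (A.cubes.cube n →₀ R) →ₗ[R] ⋀[R]^n (S.letter →₀ R) :=
  Finsupp.linearCombination R fun x : A.cubes.cube n =>
    S.wedge R fun i : Fin n => A.label (A.cubes.startEdge i x)

/-- The labeling chain map vanishes on boundaries. -/
theorem labelChain_comp_chainBoundary (A : HDA.{u, v} S) (n : ℕ) :
    A.labelChain R n ∘ₗ A.cubes.chainBoundary R n = 0 := by
  have key : ∀ (x : A.cubes.cube (n + 1)) (i : Fin (n + 1)),
      (fun j : Fin n => A.label (A.cubes.startEdge j (A.cubes.face 0 i x))) =
        fun j : Fin n => A.label (A.cubes.startEdge j (A.cubes.face 1 i x)) := by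
    intro x i
    funext j
    cases n with
    | zero => exact j.elim0
    | succ n =>
      obtain ⟨z, a, h⟩ := A.cubes.exists_startEdge_face i j x
      rw [h 0, h 1, A.label_face]
  refine Finsupp.lhom_ext' fun x => LinearMap.ext_ring ?_
  simp [chainBoundary, labelChain, key]

/-- The labeling of the homology, `ℓ_A([z]) = 𝔩_A(z)`. -/
def labelHomology (A : HDA.{u, v} S) (n : ℕ) :
    A.cubes.Homology R n →ₗ[R] ⋀[R]^n (S.letter →₀ R) :=
  Subquotient.lift _ _ (A.labelChain R n)
    (LinearMap.range_le_ker_iff.2 (A.labelChain_comp_chainBoundary R n))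

/-- The degree `n` part of the homology language with coefficients in `R`. -/
def homologyLanguage (A : HDA.{u, v} S) (n : ℕ) : Submodule R (⋀[R]^n (S.letter →₀ R)) :=
  LinearMap.range (A.labelHomology R n)

/-- `A` weakly implements `B` (for HDAs over the same concurrent alphabet; HDAs over different
concurrent alphabets are never related). -/
structure WeaklyImplements (A B : HDA.{u, v} S) : Prop where
  accessible : B.Accessible → A.Accessible
  coaccessible : B.Coaccessible → A.Coaccessible
  fundamentalMonoid_subset : A.fundamentalMonoid ⊆ B.fundamentalMonoid
  traceLanguage_subset : A.traceLanguage ⊆ B.traceLanguage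
  homologyLanguage_le : ∀ n : ℕ, A.homologyLanguage R n ≤ B.homologyLanguage R n

/-- Weak equivalence of HDAs. -/
def WeaklyEquivalent (A B : HDA.{u, v} S) : Prop :=
  A.WeaklyImplements R B ∧ B.WeaklyImplements R A

end Homology

end HDA

end

noncomputable section

namespace PrecubicalSet

/-! ## Stars of vertices of regular cubes -/

/-! Write v for the removed vertex. Everything that touches v lies in the regular cube x, so each
comparison of the two automata reduces to the combinatorics of the standard cube.

Paths: an edge e ending in v and an edge f starting in v are edges of x in different directions,
since no coordinate can increase twice. Hence they span a square, and its other two edges form a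
path with the same ends that avoids v (`exists_square_of_regular`). Opposite edges of a square have
equal labels and adjacent ones have independent labels, so the detour has the same trace. Rerouting
at every visit to v gives `Reach.removeStar`. A coordinate 0 of v provides an edge out of v and a
coordinate 1 an edge into v; these handle paths that end or begin at v itself.

Homology: pair each cell (k₁, c) of x with ([0,1], c). The first is a face of the second exactly
once, with coefficient ±1. Subtracting boundaries of cells ([0,1], c) makes a cycle vanish on the
whole closed face d^{k₁}_1 x (`exists_sub_boundary_apply_eq_zero`). Its boundary being zero at (k₁,
c) then forces the coefficient at ([0,1], c) to vanish whenever (k₁, c) is in the star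
(`apply_eq_zero_of_mem_star`). The modified cycle lives in the complement of the star and has the
same label, because labels vanish on boundaries. -/

/-- The vertex `(k₁, …, kₙ)` of the precubical `n`-cube. -/
def CubeCell.vertex : {n : ℕ} → (Fin n → Fin 2) → CubeCell n 0
  | 0, _ => .nil
  | _ + 1, k => .vert (k 0) (CubeCell.vertex fun i => k i.succ)

theorem corner_eq_sharp {n : ℕ} (P : PrecubicalSet.{u}) (k : Fin n → Fin 2) (x : P.cube n) :
    P.corner k x = sharp (CubeCell.vertex k) P x := by
  induction n with
  | zero => rfl
  | succ n ih => exact ih _ _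

theorem CubeCell.face_edge_zero (l : Fin 2) {n m : ℕ} (c : CubeCell n m) :
    (CubeCell.edge c).face l 0 = .vert l c := by
  cases m <;> rfl

theorem CubeCell.face_edge_succ (l : Fin 2) {n m : ℕ} (c : CubeCell n (m + 1)) (i : Fin (m + 1)) :
    (CubeCell.edge c).face l i.succ = .edge (c.face l i) := rfl

theorem sharp_vert {n m p : ℕ} (d : CubeCell m p) (l : Fin 2) (c : CubeCell n m) :
    sharp d (stdCube (n + 1)) (CubeCell.vert l c) = CubeCell.vert l (sharp d (stdCube n) c) :=
  sharp_natural d (P := stdCube n) (Q := stdCube (n + 1))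
    ⟨fun _ c => .vert l c, fun _ _ _ _ => rfl⟩ c

theorem vert_mem_star_vertex {n m : ℕ} {k : Fin (n + 1) → Fin 2} {l : Fin 2} {c : CubeCell n m} :
    CubeCell.vert l c ∈ star (P := stdCube (n + 1)) (CubeCell.vertex k) m ↔
      l = k 0 ∧ c ∈ star (P := stdCube n) (CubeCell.vertex fun i => k i.succ) m := by
  constructor
  · rintro ⟨d, hd⟩
    have h := CubeCell.vert.inj ((sharp_vert d l c).symm.trans hd)
    exact ⟨h.1, d, h.2⟩
  · rintro ⟨rfl, d, hd⟩
    exact ⟨d, (sharp_vert d _ c).trans (congrArg _ hd)⟩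

/-- A free first coordinate can be specialised to `k 0`, so it imposes no condition. With
`vert_mem_star_vertex`, the star is a union of pairs (k₁, c), ([0,1], c). -/
theorem edge_mem_star_vertex {n m : ℕ} {k : Fin (n + 1) → Fin 2} {c : CubeCell n m} :
    CubeCell.edge c ∈ star (P := stdCube (n + 1)) (CubeCell.vertex k) (m + 1) ↔
      c ∈ star (P := stdCube n) (CubeCell.vertex fun i => k i.succ) m := by
  have key : ∀ (l : Fin 2) (d : CubeCell m 0),
      sharp (.vert l d) (stdCube (n + 1)) (CubeCell.edge c) =
        CubeCell.vert l (sharp d (stdCube n) c) := fun l d =>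
    (congrArg (sharp d (stdCube (n + 1))) (CubeCell.face_edge_zero l c)).trans (sharp_vert d l c)
  constructor
  · rintro ⟨d, hd⟩
    cases d with
    | vert l d =>
      exact ⟨d, (CubeCell.vert.inj ((key l d).symm.trans hd)).2⟩
  · rintro ⟨d, hd⟩
    exact ⟨.vert (k 0) d, (key _ d).trans (congrArg _ hd)⟩

theorem sharp_sharp {n m p : ℕ} (d : CubeCell m p) (c : CubeCell n m) (P : PrecubicalSet.{u})
    (x : P.cube n) : sharp d P (sharp c P x) = sharp (sharp d (stdCube n) c) P x :=
  sharp_natural d (sharpHom x) c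

theorem sharp_mem_star {n m p : ℕ} {P : PrecubicalSet.{u}} {x : P.cube n} {c : CubeCell n m}
    {b : CubeCell n p} (h : c ∈ star (P := stdCube n) b m) :
    sharp c P x ∈ star (sharp b P x) m := by
  obtain ⟨d, rfl⟩ := h
  exact ⟨d, sharp_sharp d c P x⟩

/-- Iterated faces of cells of x are computed in the standard cube, and injectivity of x_♯ reflects
their coincidences. -/
theorem IsRegular.sharp_mem_star_iff {n m p : ℕ} {P : PrecubicalSet.{u}} {x : P.cube n}
    (hx : IsRegular x) {c : CubeCell n m} {b : CubeCell n p} :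
    sharp c P x ∈ star (sharp b P x) m ↔ c ∈ star (P := stdCube n) b m := by
  refine ⟨?_, sharp_mem_star⟩
  rintro ⟨d, hd⟩
  exact ⟨d, hx p ((sharp_sharp d c P x).symm.trans hd)⟩

theorem mem_star_zero {P : PrecubicalSet.{u}} {v q : P.cube 0} : q ∈ star v 0 ↔ q = v := by
  constructor
  · rintro ⟨c, hc⟩
    cases c
    exact hc
  · rintro rfl
    exact ⟨.nil, rfl⟩

theorem mem_star_one {P : PrecubicalSet.{u}} {v : P.cube 0} {e : P.cube 1} :
    e ∈ star v 1 ↔ ∃ l, P.face l 0 e = v := by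
  constructor
  · rintro ⟨c, hc⟩
    cases c with
    | vert l c =>
      cases c
      exact ⟨l, hc⟩
  · rintro ⟨l, hl⟩
    exact ⟨.vert l .nil, hl⟩

/-- Stars are closed under passing to cofaces, because their complements are closed under faces. -/
theorem mem_star_of_face {P : PrecubicalSet.{u}} {v : P.cube 0} {n : ℕ} {l : Fin 2}
    {i : Fin (n + 1)} {y : P.cube (n + 1)} (h : P.face l i y ∈ star v n) : y ∈ star v (n + 1) := by
  by_contra hy
  exact (starCompl v).face_mem l i y hy h

theorem CubeCell.face_zero_ne_face_one {n m : ℕ} (c : CubeCell n (m + 1)) (i : Fin (m + 1)) :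
    c.face 0 i ≠ c.face 1 i := by
  induction n generalizing m with
  | zero => cases c
  | succ n ih =>
    cases c with
    | vert l c => simpa [CubeCell.face] using ih c i
    | edge c =>
      cases i using Fin.cases with
      | zero => simp [CubeCell.face_edge_zero]
      | succ i =>
        cases m with
        | zero => exact i.elim0
        | succ m => simpa [CubeCell.face_edge_succ] using ih c i

/-- Two composable edges of the precubical `n`-cube span a square. -/
theorem CubeCell.exists_square {n : ℕ} (c d : CubeCell n 1) (h : c.face 1 0 = d.face 0 0) :
    ∃ (q : CubeCell n 2) (a : Fin 2), q.face 0 a = c ∧ q.face 1 a.rev = d ∧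
      (q.face 0 a.rev).face 1 0 ≠ c.face 1 0 := by
  induction n with
  | zero => cases c
  | succ n ih =>
    cases c with
    | vert l c =>
      cases d with
      | vert l' d =>
        simp only [CubeCell.face, CubeCell.vert.injEq] at h
        obtain ⟨rfl, h⟩ := h
        obtain ⟨q, a, rfl, rfl, hq⟩ := ih c d h
        exact ⟨.vert l q, a, rfl, rfl, by simpa [CubeCell.face] using hq⟩
      | edge d =>
        simp only [CubeCell.face, CubeCell.vert.injEq] at h
        obtain ⟨rfl, rfl⟩ := h
        exact ⟨.edge c, 0, rfl, rfl, by
          change CubeCell.vert 1 _ ≠ _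
          simp [CubeCell.face]⟩
    | edge c =>
      cases d with
      | vert l d =>
        simp only [CubeCell.face, CubeCell.vert.injEq] at h
        obtain ⟨rfl, rfl⟩ := h
        exact ⟨.edge d, 1, rfl, rfl, by
          change CubeCell.vert 0 _ ≠ _
          simp [CubeCell.face]⟩
      -- Both edges would raise the first coordinate from 0 to 1, which is impossible for composable
      -- edges.
      | edge d => simp [CubeCell.face] at h

theorem CubeCell.exists_edge {n : ℕ} (k : Fin n → Fin 2) (i : Fin n) :
    ∃ c : CubeCell n 1, c.face (k i) 0 = CubeCell.vertex k := by
  induction n with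
  | zero => exact i.elim0
  | succ n ih =>
    cases i using Fin.cases with
    | zero => exact ⟨.edge (CubeCell.vertex fun i => k i.succ), rfl⟩
    | succ i =>
      obtain ⟨c, hc⟩ := ih (fun i => k i.succ) i
      exact ⟨.vert (k 0) c, congrArg (CubeCell.vert (k 0)) hc⟩

/-- If the star of the vertex `v` lies in a regular cube, then consecutive edges through `v`
belong to a square in which the opposite path avoids `v`. -/
theorem exists_square_of_regular {P : PrecubicalSet.{u}} {n : ℕ} {x : P.cube n}
    (hx : IsRegular x) {v : P.cube 0}
    (hstar : star v 1 ⊆ Set.range ((sharpHom x).app 1))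
    {e f : P.cube 1} (he : P.face 1 0 e = v) (hf : P.face 0 0 f = v) :
    ∃ (z : P.cube 2) (a : Fin 2), P.face 0 a z = e ∧ P.face 1 a.rev z = f ∧
      P.face 0 a.rev z ∉ star v 1 ∧ P.face 1 a z ∉ star v 1 ∧
      P.face 0 0 e ≠ v ∧
      P.face 0 0 (P.face 0 a.rev z) = P.face 0 0 e ∧
      P.face 1 0 (P.face 0 a.rev z) = P.face 0 0 (P.face 1 a z) ∧
      P.face 1 0 (P.face 1 a z) = P.face 1 0 f := by
  obtain ⟨c, rfl⟩ := hstar (mem_star_one.2 ⟨1, he⟩)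
  obtain ⟨d, rfl⟩ := hstar (mem_star_one.2 ⟨0, hf⟩)
  have hs : ∀ (l : Fin 2) {m : ℕ} (i : Fin (m + 1)) (q : CubeCell n (m + 1)),
      P.face l i ((sharpHom x).app (m + 1) q) = (sharpHom x).app m (q.face l i) :=
    fun l m i q => ((sharpHom x).app_face l i q).symm
  -- Regularity turns the equality of the end of e and the start of f in `P` into an equality in the
  -- standard cube.
  obtain ⟨q, a, rfl, rfl, hq⟩ := CubeCell.exists_square c d
    (hx 0 (((hs 1 0 c).symm.trans (he.trans hf.symm)).trans (hs 0 0 d)))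
  -- Both sides are the corner of the square with coordinate `a` equal to `l` and coordinate `a.rev`
  -- equal to `l'`. The vertex v is the corner 0, 1 in this order; the next three facts say that the
  -- other corners differ from it.
  have hz : ∀ l l' : Fin 2, P.face l 0 (P.face l' a.rev ((sharpHom x).app 2 q)) =
      P.face l' 0 (P.face l a ((sharpHom x).app 2 q)) := by
    intro l l'
    fin_cases a
    · exact P.face_face l l' 0 0 le_rfl _
    · exact (P.face_face l' l 0 0 le_rfl _).symm
  have h00 : P.face 0 0 (P.face 0 a ((sharpHom x).app 2 q)) ≠ v := by
    rw [← he, hs, hs, hs]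
    exact fun h => CubeCell.face_zero_ne_face_one _ _ (hx 0 h)
  have h11 : P.face 1 0 (P.face 1 a.rev ((sharpHom x).app 2 q)) ≠ v := by
    rw [← hf, hs, hs, hs]
    exact fun h => CubeCell.face_zero_ne_face_one _ _ (hx 0 h).symm
  have hm : P.face 1 0 (P.face 0 a.rev ((sharpHom x).app 2 q)) ≠ v := by
    rw [← he, hs, hs, hs]
    exact fun h => hq (hx 0 h)
  refine ⟨(sharpHom x).app 2 q, a, hs _ _ _, hs _ _ _, ?_, ?_, ?_, ?_, hz _ _, ?_⟩
  · rw [mem_star_one, Fin.exists_fin_two, not_or]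
    exact ⟨by rwa [hz], hm⟩
  · rw [mem_star_one, Fin.exists_fin_two, not_or]
    exact ⟨by rwa [← hz], by rwa [← hz]⟩
  · rwa [← hs]
  · rw [hz, hs 0 a]
  · rw [← hz, hs 1 a.rev]

/-! ## Paths -/

/-- The path with given vertices and edges. -/
def Path.mk' {P : PrecubicalSet.{u}} {l : ℕ} (p : Fin (l + 1) → P.cube 0) (e : Fin l → P.cube 1)
    (h : ∀ (k : Fin 2) j, P.face k 0 (e j) = p (if k = 0 then j.castSucc else j.succ)) :
    P.Path l where
  app
    | 0 => p
    | 1 => e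
    | _ + 2 => Empty.elim
  app_face k n i x := by
    match n with
    | 0 =>
      obtain rfl := Fin.fin_one_eq_zero i
      exact (h k x).symm
    | _ + 1 => exact Empty.elim x

theorem Path.face_edge {P : PrecubicalSet.{u}} {l : ℕ} (ω : P.Path l) (k : Fin 2) (j : Fin l) :
    P.face k 0 (ω.edge j) = ω.vertex (if k = 0 then j.castSucc else j.succ) :=
  (ω.app_face k (n := 0) 0 j).symm

end PrecubicalSet

/-! ### Commutation in the trace monoid -/

namespace ConcurrentAlphabet

theorem trace_mul (S : ConcurrentAlphabet.{v}) (a b : FreeMonoid S.letter) :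
    S.trace (a * b) = S.trace a * S.trace b := rfl

/-- Independent words commute in the trace monoid. -/
theorem commute_trace (S : ConcurrentAlphabet.{v}) {p q : FreeMonoid S.letter}
    (h : ∀ a ∈ p.toList, ∀ b ∈ q.toList, ¬ S.dep a b) : Commute (S.trace p) (S.trace q) := by
  induction p using FreeMonoid.inductionOn' with
  | one => exact Commute.one_left _
  | of_mul a p ihp =>
    rw [trace_mul]
    refine Commute.mul_left ?_ (ihp fun a' ha' => h a' (by simp [ha']))
    replace h := h a (by simp)
    clear ihp
    induction q using FreeMonoid.inductionOn' with
    | one => exact Commute.one_right _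
    | of_mul b q ihq =>
      rw [trace_mul]
      refine Commute.mul_right ?_ (ihq fun b' hb' => h b' (by simp [hb']))
      exact (Con.eq _).2 (ConGen.Rel.of _ _ ⟨a, b, h b (by simp), rfl, rfl⟩)

end ConcurrentAlphabet

/-! ### Traces of paths and rerouting around a vertex -/

namespace HDA

open PrecubicalSet

variable {S : ConcurrentAlphabet.{v}}

/-- `A.Reach a b t`: there is a path from `a` to `b` whose label has trace `t`. -/
inductive Reach (A : HDA.{u, v} S) (a : A.cubes.cube 0) : A.cubes.cube 0 → S.TraceMonoid → Prop
  | refl : Reach A a a 1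
  | snoc {b c : A.cubes.cube 0} {t : S.TraceMonoid} (h : Reach A a b t) (e : A.cubes.cube 1)
      (h0 : A.cubes.face 0 0 e = b) (h1 : A.cubes.face 1 0 e = c) :
      Reach A a c (t * S.trace (A.label e))

theorem Reach.trans {A : HDA.{u, v} S} {a b c : A.cubes.cube 0} {s t : S.TraceMonoid}
    (h : A.Reach a b s) (h' : A.Reach b c t) : A.Reach a c (s * t) := by
  induction h' with
  | refl => rwa [mul_one]
  | snoc _ e h0 h1 ih =>
    rw [← mul_assoc]
    exact ih.snoc e h0 h1

/-- Accessibility, coaccessibility and both languages depend only on end points and traces of paths,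
and `Reach` allows induction edge by edge. -/
theorem reach_iff {A : HDA.{u, v} S} {a b : A.cubes.cube 0} {t : S.TraceMonoid} :
    A.Reach a b t ↔ ∃ (l : ℕ) (ω : A.cubes.Path l), ω.source = a ∧ ω.target = b ∧
      S.trace (A.pathLabel ω) = t := by
  constructor
  · intro h
    induction h with
    | refl => exact ⟨0, Path.mk' (fun _ => a) Fin.elim0 fun _ j => j.elim0, rfl, rfl, rfl⟩
    | @snoc b c t _ e h0 h1 ih =>
      obtain ⟨l, ω, rfl, rfl, rfl⟩ := ih
      refine ⟨l + 1, Path.mk' (Fin.snoc (α := fun _ => A.cubes.cube 0) ω.vertex c)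
        (Fin.snoc (α := fun _ => A.cubes.cube 1) ω.edge e) ?_, ?_, ?_, ?_⟩
      · intro k j
        cases j using Fin.lastCases with
        | last =>
          rw [Fin.snoc_last]
          obtain rfl | rfl : k = 0 ∨ k = 1 := by omega
          · rw [if_pos rfl, Fin.snoc_castSucc]
            exact h0
          · rw [if_neg (by decide), Fin.succ_last, Fin.snoc_last]
            exact h1
        | cast j =>
          rw [Fin.snoc_castSucc, ω.face_edge]
          split_ifs
          · rw [Fin.snoc_castSucc]
          · rw [Fin.succ_castSucc, Fin.snoc_castSucc]
      · exact Fin.snoc_castSucc (α := fun _ => A.cubes.cube 0) c ω.vertex 0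
      · exact Fin.snoc_last (α := fun _ => A.cubes.cube 0) c ω.vertex
      · change S.trace (List.ofFn fun j : Fin (l + 1) =>
          A.label (Fin.snoc (α := fun _ => A.cubes.cube 1) ω.edge e j)).prod = _
        rw [List.ofFn_succ', List.concat_eq_append, List.prod_append,
          List.prod_singleton, ConcurrentAlphabet.trace_mul]
        simp only [Fin.snoc_castSucc, Fin.snoc_last]
        rfl
  · rintro ⟨l, ω, rfl, rfl, rfl⟩
    -- Induction over the initial segments of a fixed path avoids constructing truncated paths.
    have key : ∀ (j : ℕ) (hj : j ≤ l), A.Reach ω.source (ω.vertex ⟨j, by omega⟩)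
        (S.trace (List.ofFn fun i : Fin j => A.label (ω.edge ⟨i, by omega⟩)).prod) := by
      intro j
      induction j with
      | zero => exact fun _ => .refl
      | succ j ih =>
        intro hj
        rw [List.ofFn_succ', List.concat_eq_append, List.prod_append, List.prod_singleton,
          ConcurrentAlphabet.trace_mul]
        exact (ih (by omega)).snoc (ω.edge ⟨j, by omega⟩) (ω.face_edge 0 _) (ω.face_edge 1 _)
    exact key l le_rfl

theorem accessible_iff {A : HDA.{u, v} S} : A.Accessible ↔ ∀ b, ∃ t, A.Reach A.init b t := by
  simp only [reach_iff]
  exact ⟨fun h b => let ⟨l, ω, h1, h2⟩ := h b; ⟨_, l, ω, h1, h2, rfl⟩,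
    fun h b => let ⟨_, l, ω, h1, h2, _⟩ := h b; ⟨l, ω, h1, h2⟩⟩

theorem coaccessible_iff {A : HDA.{u, v} S} :
    A.Coaccessible ↔ ∀ a, ∃ b ∈ A.final, ∃ t, A.Reach a b t := by
  simp only [reach_iff]
  exact ⟨fun h a => let ⟨l, ω, h1, h2⟩ := h a; ⟨_, h2, _, l, ω, h1, rfl, rfl⟩,
    fun h a => let ⟨_, h2, _, l, ω, h1, h3, _⟩ := h a; ⟨l, ω, h1, h3 ▸ h2⟩⟩

theorem mem_fundamentalMonoid {A : HDA.{u, v} S} {t : S.TraceMonoid} :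
    t ∈ A.fundamentalMonoid ↔ A.Reach A.init A.init t :=
  reach_iff.symm

theorem mem_traceLanguage {A : HDA.{u, v} S} {t : S.TraceMonoid} :
    t ∈ A.traceLanguage ↔ ∃ b t', A.Reach A.init b (t * t') := by
  simp only [reach_iff]
  exact ⟨fun ⟨l, ω, h, t', ht⟩ => ⟨_, t', l, ω, h, rfl, ht⟩,
    fun ⟨_, t', l, ω, h, _, ht⟩ => ⟨l, ω, h, t', ht⟩⟩

/-- Starting edges of a square have commuting traces. -/
theorem commute_trace_label (A : HDA.{u, v} S) (z : A.cubes.cube 2) :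
    Commute (S.trace (A.label (A.cubes.face 0 0 z))) (S.trace (A.label (A.cubes.face 0 1 z))) :=
  S.commute_trace fun a ha b hb hab =>
    (A.label_indep z a b hab).elim (fun h => h ha) fun h => h hb

theorem Reach.of_sub {A : HDA.{u, v} S} {Q : A.cubes.Subset} {h : A.init ∈ Q.carrier 0}
    {a b : (A.sub Q h).cubes.cube 0} {t : S.TraceMonoid} (hr : (A.sub Q h).Reach a b t) :
    A.Reach a.1 b.1 t := by
  induction hr with
  | refl => exact .refl
  | snoc _ e h0 h1 ih => exact ih.snoc e.1 (congrArg Subtype.val h0) (congrArg Subtype.val h1)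

/-- Paths between vertices different from `v` can be rerouted around `v`. -/
theorem Reach.removeStar {A : HDA.{u, v} S} {n : ℕ} {x : A.cubes.cube n} (hx : IsRegular x)
    {v : A.cubes.cube 0} (hv : v ≠ A.init)
    (hstar : star v 1 ⊆ Set.range ((sharpHom x).app 1))
    {a b : A.cubes.cube 0} {t : S.TraceMonoid} (ha : v ≠ a) (h : A.Reach a b t) (hb : v ≠ b) :
    (A.removeStar v hv).Reach ⟨a, mem_starCompl_zero ha⟩ ⟨b, mem_starCompl_zero hb⟩ t := by
  -- A path that has just arrived at v has no counterpart in the complement. The induction therefore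
  -- carries a second clause: such a path together with any next edge `f` that leaves to a vertex
  -- other than v can be rerouted.
  suffices key : (∀ hb : v ≠ b, (A.removeStar v hv).Reach ⟨a, mem_starCompl_zero ha⟩
      ⟨b, mem_starCompl_zero hb⟩ t) ∧
      (b = v → ∀ f : A.cubes.cube 1, A.cubes.face 0 0 f = v → ∀ hf : v ≠ A.cubes.face 1 0 f,
        (A.removeStar v hv).Reach ⟨a, mem_starCompl_zero ha⟩ ⟨_, mem_starCompl_zero hf⟩
          (t * S.trace (A.label f))) from key.1 hb
  clear hb
  induction h with
  | refl => exact ⟨fun _ => .refl, fun h => absurd h.symm ha⟩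
  | @snoc b c t _ e h0 h1 ih =>
    constructor
    · intro hc
      by_cases hbv : b = v
      · have := ih.2 hbv e (h0.trans hbv) (h1 ▸ hc)
        simpa only [h1] using this
      · have he : e ∉ star v 1 := by
          rw [mem_star_one, Fin.exists_fin_two, not_or, h0, h1]
          exact ⟨hbv, hc.symm⟩
        exact (ih.1 (Ne.symm hbv)).snoc ⟨e, he⟩ (Subtype.ext h0) (Subtype.ext h1)
    · rintro rfl f hf0 hf1
      obtain ⟨z, p, rfl, rfl, hs, hs', hne, g0, g1, g2⟩ :=
        exists_square_of_regular hx hstar h1 hf0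
      have hl : A.label (A.cubes.face 0 p.rev z) = A.label (A.cubes.face 1 p.rev z) :=
        A.label_face z _
      have hl' : A.label (A.cubes.face 0 p z) = A.label (A.cubes.face 1 p z) :=
        A.label_face z _
      have hcomm : Commute (S.trace (A.label (A.cubes.face 0 p z)))
          (S.trace (A.label (A.cubes.face 0 p.rev z))) := by
        obtain rfl | rfl : p = 0 ∨ p = 1 := by omega
        · exact A.commute_trace_label z
        · exact (A.commute_trace_label z).symm
      -- The two labels are exchanged by independence and moved to the opposite edges of the square,
      -- which are the edges of the detour.
      rw [← hl, mul_assoc, hcomm.eq, ← mul_assoc, hl']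
      have hmid : c ≠ A.cubes.face 1 0 (A.cubes.face 0 p.rev z) := fun h =>
        hs (mem_star_one.2 ⟨1, h.symm⟩)
      have h2 : (A.removeStar c hv).Reach ⟨a, mem_starCompl_zero ha⟩
          ⟨_, mem_starCompl_zero hmid⟩ _ :=
        (ih.1 (h0 ▸ hne.symm)).snoc ⟨_, hs⟩ (Subtype.ext (g0.trans h0)) rfl
      exact h2.snoc ⟨_, hs'⟩ (Subtype.ext g1.symm) (Subtype.ext g2)

end HDA

/-! ## Homology -/

namespace PrecubicalSet

/-! ### Pushing cycles off the star of a vertex -/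

section Chains

variable (R : Type w) [CommRing R]

theorem chainBoundary_single_apply_of_forall_ne {P : PrecubicalSet.{u}} {m : ℕ}
    {y : P.cube (m + 1)} {q : P.cube m} (h : ∀ l i, P.face l i y ≠ q) :
    P.chainBoundary R m (Finsupp.single y 1) q = 0 := by
  classical
  simp [chainBoundary, Finsupp.finsetSum_apply, h]

/-- Only one face of `y` contributes. The exponent combines the sign of the first index with the
minus sign of the upper faces: -1 for `l = 0` and 1 for `l = 1`. -/
theorem chainBoundary_single_apply {P : PrecubicalSet.{u}} {m : ℕ} {y : P.cube (m + 1)}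
    {q : P.cube m} {l : Fin 2} (h : ∀ l' i, P.face l' i y = q ↔ i = 0 ∧ l' = l) :
    P.chainBoundary R m (Finsupp.single y 1) q = (-1) ^ ((l : ℕ) + 1) := by
  classical
  simp only [chainBoundary, Finsupp.linearCombination_single, one_smul,
    Finsupp.finsetSum_apply, Finsupp.smul_apply, Finsupp.sub_apply, Finsupp.single_apply, h]
  rw [Fin.sum_univ_succ]
  obtain rfl | rfl : l = 0 ∨ l = 1 := by omega
  · simp
  · simp

/-- This makes the pairing of (l, c) with ([0,1], c) usable: by regularity, distinct pairs do not
interfere and each incidence occurs once. -/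
theorem face_sharp_edge_eq_iff {P : PrecubicalSet.{u}} {n m : ℕ} {x : P.cube (n + 1)}
    (hx : IsRegular x) (l l' : Fin 2) (i : Fin (m + 1)) (c c' : CubeCell n m) :
    P.face l' i (sharp (.edge c) P x) = sharp (.vert l c') P x ↔
      c = c' ∧ i = 0 ∧ l' = l := by
  rw [← sharp_face]
  refine ((hx m).eq_iff (a := (CubeCell.edge c).face l' i) (b := .vert l c')).trans ?_
  cases i using Fin.cases with
  | zero =>
    rw [CubeCell.face_edge_zero]
    exact (CubeCell.vert.injEq ..).to_iff.trans (by simp [and_comm])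
  | succ i =>
    cases m with
    | zero => exact i.elim0
    | succ m => simp [CubeCell.face_edge_succ]

/-- Up to boundaries, a chain vanishes on the closed face `d^l_1 x` of a regular cube `x`. -/
theorem exists_sub_boundary_apply_eq_zero {P : PrecubicalSet.{u}} {n : ℕ} {x : P.cube (n + 1)}
    (hx : IsRegular x) (l : Fin 2) {m : ℕ} (z : P.cube m →₀ R) :
    ∃ w, ∀ c : CubeCell n m, (z - P.chainBoundary R m w) (sharp (.vert l c) P x) = 0 := by
  induction z using Finsupp.induction_linear with
  | zero => exact ⟨0, by simp⟩
  | add z z' h h' =>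
    obtain ⟨w, hw⟩ := h
    obtain ⟨w', hw'⟩ := h'
    refine ⟨w + w', fun c => ?_⟩
    rw [map_add, add_sub_add_comm, Finsupp.add_apply, hw, hw', add_zero]
  | single y a =>
    by_cases hy : ∃ c : CubeCell n m, sharp (.vert l c) P x = y
    · obtain ⟨c, rfl⟩ := hy
      -- The incidence coefficient is its own inverse, so this multiple of the paired cell cancels
      -- `a`.
      refine ⟨(a * (-1) ^ ((l : ℕ) + 1)) • Finsupp.single (sharp (.edge c) P x) 1, fun c' => ?_⟩
      rw [map_smul, Finsupp.sub_apply, Finsupp.smul_apply]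
      by_cases hc : c = c'
      · subst hc
        rw [chainBoundary_single_apply R (l := l)
          fun l' i => by simpa using face_sharp_edge_eq_iff hx l l' i c c]
        rw [smul_eq_mul, mul_assoc, ← mul_pow]
        simp
      · rw [chainBoundary_single_apply_of_forall_ne R
          fun l' i h => hc ((face_sharp_edge_eq_iff hx l l' i c c').1 h).1,
          Finsupp.single_eq_of_ne]
        · simp
        · intro h
          exact hc (CubeCell.vert.inj (hx m (a₁ := .vert l c') (a₂ := .vert l c) h)).2.symm
    · refine ⟨0, fun c => ?_⟩
      rw [map_zero, sub_zero, Finsupp.single_eq_of_ne fun h => hy ⟨c, h⟩]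

/-- A cycle that vanishes on the face `d^{k₁}_1 x` of a regular cube `x` also vanishes on the star
of the vertex `v = d^{kₙ}_1 ⋯ d^{k₁}_1 x` if this is contained in `x`. -/
theorem apply_eq_zero_of_mem_star {P : PrecubicalSet.{u}} {n : ℕ} {x : P.cube (n + 1)}
    (hx : IsRegular x) (k : Fin (n + 1) → Fin 2)
    (hstar : ∀ m, star (sharp (CubeCell.vertex k) P x) m ⊆ Set.range ((sharpHom x).app m))
    {m : ℕ} {z : P.cube m →₀ R} (hz : z ∈ P.chainCycles R m)
    (h0 : ∀ c : CubeCell n m, z (sharp (.vert (k 0) c) P x) = 0)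
    {y : P.cube m} (hy : y ∈ star (sharp (CubeCell.vertex k) P x) m) : z y = 0 := by
  obtain ⟨b, rfl⟩ := hstar m hy
  have hb := hx.sharp_mem_star_iff.1 hy
  cases b with
  | vert l c =>
    obtain ⟨rfl, -⟩ := vert_mem_star_vertex.1 hb
    exact h0 c
  | @edge _ m c =>
    have hc := edge_mem_star_vertex.1 hb
    -- The cycle condition is read off at the partner (k₁, c); the aim is that only ([0,1], c)
    -- contributes.
    have hz' : P.chainBoundary R m z (sharp (.vert (k 0) c) P x) = 0 := by
      rw [LinearMap.mem_ker.1 hz, Finsupp.zero_apply]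
    have hsum : P.chainBoundary R m z = z.sum fun y a =>
        a • P.chainBoundary R m (Finsupp.single y 1) := by
      simp [chainBoundary, Finsupp.linearCombination_apply]
    rw [hsum, Finsupp.sum, Finsupp.finsetSum_apply,
      Finset.sum_eq_single (sharp (.edge c) P x), Finsupp.smul_apply,
      chainBoundary_single_apply R (l := k 0)
        fun l' i => by simpa using face_sharp_edge_eq_iff hx (k 0) l' i c c, smul_eq_mul] at hz'
    · have := congrArg (· * (-1 : R) ^ ((k 0 : ℕ) + 1)) hz'
      simp only [mul_assoc, ← mul_pow, zero_mul] at this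
      simp only [neg_mul_neg, one_pow, mul_one] at this
      exact this
    · intro y hyz hyc
      rw [Finsupp.smul_apply, chainBoundary_single_apply_of_forall_ne, smul_zero]
      intro l i hli
      -- Any coface of (k₁, c) is again in the star, hence in x: either it lies in the face where
      -- the cycle vanishes, or it has the form ([0,1], d), and then d = c.
      have hcs : sharp (.vert (k 0) c) P x ∈ star (sharp (CubeCell.vertex k) P x) m :=
        hx.sharp_mem_star_iff.2 (vert_mem_star_vertex.2 ⟨rfl, hc⟩)
      have hys : y ∈ star (sharp (CubeCell.vertex k) P x) (m + 1) :=
        mem_star_of_face (hli ▸ hcs)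
      obtain ⟨d, rfl⟩ := hstar _ hys
      have hd := hx.sharp_mem_star_iff.1 hys
      cases d with
      | vert l' d =>
        obtain ⟨rfl, -⟩ := vert_mem_star_vertex.1 hd
        exact Finsupp.mem_support_iff.1 hyz (h0 d)
      | edge d =>
        obtain ⟨rfl, -⟩ := (face_sharp_edge_eq_iff hx (k 0) l i d c).1 hli
        exact hyc rfl
    · intro hyz
      rw [Finsupp.notMem_support_iff.1 hyz, zero_smul, Finsupp.zero_apply]

/-! ### Chains of a precubical subset -/

/-- The inclusion of a precubical subset. -/
def Subset.inclusion {P : PrecubicalSet.{u}} (Q : P.Subset) : Hom Q.toPrecubicalSet P where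
  app _ y := y.1
  app_face _ _ _ _ := rfl

theorem Subset.inclusion_injective {P : PrecubicalSet.{u}} (Q : P.Subset) (m : ℕ) :
    Function.Injective (Q.inclusion.app m) :=
  Subtype.val_injective

/-- The inclusion of the chains of a precubical subset. -/
def Subset.chainMap {P : PrecubicalSet.{u}} (Q : P.Subset) (m : ℕ) :
    (Q.toPrecubicalSet.cube m →₀ R) →ₗ[R] (P.cube m →₀ R) :=
  Finsupp.lmapDomain R R (Q.inclusion.app m)

theorem Subset.chainMap_single {P : PrecubicalSet.{u}} (Q : P.Subset) (m : ℕ)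
    (y : Q.toPrecubicalSet.cube m) :
    Q.chainMap R m (Finsupp.single y 1) = Finsupp.single (Q.inclusion.app m y) 1 :=
  Finsupp.mapDomain_single

theorem Subset.chainMap_injective {P : PrecubicalSet.{u}} (Q : P.Subset) (m : ℕ) :
    Function.Injective (Q.chainMap R m) :=
  Finsupp.mapDomain_injective (Q.inclusion_injective m)

theorem Subset.chainBoundary_chainMap {P : PrecubicalSet.{u}} (Q : P.Subset) (m : ℕ)
    (z : Q.toPrecubicalSet.cube (m + 1) →₀ R) :
    P.chainBoundary R m (Q.chainMap R (m + 1) z) =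
      Q.chainMap R m (Q.toPrecubicalSet.chainBoundary R m z) := by
  have : P.chainBoundary R m ∘ₗ Q.chainMap R (m + 1) =
      Q.chainMap R m ∘ₗ Q.toPrecubicalSet.chainBoundary R m := by
    refine Finsupp.lhom_ext' fun y => LinearMap.ext_ring ?_
    change P.chainBoundary R m (Q.chainMap R (m + 1) (Finsupp.single y 1)) =
      Q.chainMap R m (Q.toPrecubicalSet.chainBoundary R m (Finsupp.single y 1))
    simp only [chainBoundary, chainMap_single, Finsupp.linearCombination_single, one_smul,
      map_sum, map_smul, map_sub, Q.inclusion.app_face]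
  exact LinearMap.congr_fun this z

theorem Subset.chainMap_mem_chainCycles {P : PrecubicalSet.{u}} (Q : P.Subset) {m : ℕ}
    {z : Q.toPrecubicalSet.cube m →₀ R} :
    Q.chainMap R m z ∈ P.chainCycles R m ↔ z ∈ Q.toPrecubicalSet.chainCycles R m := by
  cases m with
  | zero => simp [chainCycles]
  | succ m =>
    refine LinearMap.mem_ker.trans (Iff.trans ?_ LinearMap.mem_ker.symm)
    rw [Q.chainBoundary_chainMap R]
    exact map_eq_zero_iff _ (Q.chainMap_injective R m)

theorem Subset.exists_chainMap_eq {P : PrecubicalSet.{u}} (Q : P.Subset) {m : ℕ}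
    {z : P.cube m →₀ R} (hz : ∀ y ∉ Q.carrier m, z y = 0) : ∃ b, Q.chainMap R m b = z := by
  refine ⟨z.comapDomain _ (Q.inclusion_injective m).injOn,
    Finsupp.mapDomain_comapDomain _ (Q.inclusion_injective m) z ?_⟩
  intro y hy
  by_contra h
  exact Finsupp.mem_support_iff.1 hy (hz y fun hq => h ⟨⟨y, hq⟩, rfl⟩)

/-! ### Boundaries are cycles -/

theorem chainBoundary_single (P : PrecubicalSet.{u}) (m : ℕ) (y : P.cube (m + 1)) :
    P.chainBoundary R m (Finsupp.single y 1) = ∑ p : Fin 2 × Fin (m + 1),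
      (-1 : R) ^ ((p.1 : ℕ) + p.2 + 1) • Finsupp.single (P.face p.1 p.2 y) (1 : R) := by
  simp only [chainBoundary, Finsupp.linearCombination_single, one_smul, Fintype.sum_prod_type,
    Fin.sum_univ_two, ← Finset.sum_add_distrib]
  refine Finset.sum_congr rfl fun i _ => ?_
  rw [smul_sub, sub_eq_add_neg, ← neg_smul]
  simp only [Fin.val_zero, Fin.val_one, zero_add, add_assoc, pow_add]
  simp

/-- Stating the cubical identity through `succAbove` and `predAbove` treats both orders of the
indices at once, as needed for the cancelling involution on double faces. -/
theorem face_face_eq (P : PrecubicalSet.{u}) (k l : Fin 2) {m : ℕ} (i : Fin (m + 1))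
    (j : Fin (m + 2)) (x : P.cube (m + 2)) :
    P.face k i (P.face l j x) = P.face l (i.predAbove j) (P.face k (j.succAbove i) x) := by
  rcases lt_or_ge i.castSucc j with h | h
  · rw [Fin.succAbove_of_castSucc_lt _ _ h, Fin.predAbove_of_castSucc_lt _ _ h,
      ← P.face_face k l i _ (Fin.le_pred_iff _ |>.2 (Fin.castSucc_lt_iff_succ_le.1 h)),
      Fin.succ_pred]
  · rw [Fin.succAbove_of_le_castSucc _ _ h, Fin.predAbove_of_le_castSucc _ _ h,
      P.face_face l k _ i ((Fin.castPred_le_iff _).2 h), Fin.castSucc_castPred]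

theorem chainBoundary_mem_chainCycles (P : PrecubicalSet.{u}) (m : ℕ)
    (w : P.cube (m + 1) →₀ R) : P.chainBoundary R m w ∈ P.chainCycles R m := by
  cases m with
  | zero => exact Submodule.mem_top
  | succ m =>
    suffices h : P.chainBoundary R m ∘ₗ P.chainBoundary R (m + 1) = 0 from
      LinearMap.mem_ker.2 (LinearMap.congr_fun h w)
    refine Finsupp.lhom_ext' fun x => LinearMap.ext_ring ?_
    change P.chainBoundary R m (P.chainBoundary R (m + 1) (Finsupp.single x 1)) = 0
    simp only [chainBoundary_single, map_sum, map_smul, Finset.smul_sum, smul_smul, ← pow_add]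
    rw [← Fintype.sum_prod_type']
    -- Each double face arises from two orders of the boundary operators; exchanging the order flips
    -- the sign.
    refine Finset.sum_involution
      (fun p _ => ((p.2.1, p.1.2.succAbove p.2.2), (p.1.1, p.2.2.predAbove p.1.2)))
      ?_ ?_ (fun _ _ => Finset.mem_univ _) ?_
    · rintro ⟨⟨l, j⟩, k, i⟩ -
      simp only
      rw [P.face_face_eq, ← add_smul]
      have := Fin.neg_one_pow_succAbove_add_predAbove (R := R) j i
      have h : ∀ a b : ℕ, (-1 : R) ^ ((l : ℕ) + a + 1 + (k + b + 1)) =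
          (-1) ^ ((l : ℕ) + k) * (-1) ^ (a + b) := fun a b => by ring
      have h' : ∀ a b : ℕ, (-1 : R) ^ ((k : ℕ) + a + 1 + (l + b + 1)) =
          (-1) ^ ((l : ℕ) + k) * (-1) ^ (a + b) := fun a b => by ring
      rw [h, h', this]
      simp
    · rintro ⟨⟨l, j⟩, k, i⟩ - - h
      -- No fixed points: the exchanged outer index skips `j`.
      exact Fin.succAbove_ne j i (congrArg (fun p => p.1.2) h)
    · rintro ⟨⟨l, j⟩, k, i⟩ -
      simp [Fin.succAbove_succAbove_predAbove, Fin.predAbove_predAbove_succAbove]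

end Chains

end PrecubicalSet

/-! ### Homology languages of sub-automata -/

namespace HDA

open PrecubicalSet

variable {S : ConcurrentAlphabet.{v}}

section Homology

variable (R : Type w) [CommRing R]

/-- The induced map on classes has the same image as the chain map on cycles, so no homology groups
need to be compared. -/
theorem mem_homologyLanguage {A : HDA.{u, v} S} {n : ℕ} {t : ⋀[R]^n (S.letter →₀ R)} :
    t ∈ A.homologyLanguage R n ↔ ∃ z ∈ A.cubes.chainCycles R n, A.labelChain R n z = t := by
  constructor
  · rintro ⟨q, rfl⟩
    obtain ⟨z, rfl⟩ := Submodule.Quotient.mk_surjective _ q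
    exact ⟨z.1, z.2, rfl⟩
  · rintro ⟨z, hz, rfl⟩
    exact ⟨Submodule.Quotient.mk ⟨z, hz⟩, rfl⟩

theorem startEdge_sub {P : PrecubicalSet.{u}} (Q : P.Subset) {n : ℕ} (i : Fin n)
    (y : Q.toPrecubicalSet.cube n) :
    (Q.toPrecubicalSet.startEdge i y).1 = P.startEdge i y.1 := by
  induction n with
  | zero => exact i.elim0
  | succ n ih =>
    cases n with
    | zero => rfl
    | succ n =>
      cases i using Fin.lastCases with
      | last =>
        simp only [startEdge, Fin.lastCases_last]
        exact ih _ _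
      | cast i =>
        simp only [startEdge, Fin.lastCases_castSucc]
        exact ih _ _

theorem labelChain_chainMap (A : HDA.{u, v} S) (Q : A.cubes.Subset) (h : A.init ∈ Q.carrier 0)
    (n : ℕ) (z : Q.toPrecubicalSet.cube n →₀ R) :
    A.labelChain R n (Q.chainMap R n z) = (A.sub Q h).labelChain R n z := by
  have : A.labelChain R n ∘ₗ Q.chainMap R n = (A.sub Q h).labelChain R n := by
    refine Finsupp.lhom_ext' fun y => LinearMap.ext_ring ?_
    change A.labelChain R n (Q.chainMap R n (Finsupp.single y 1)) =
      (A.sub Q h).labelChain R n (Finsupp.single y 1)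
    rw [Subset.chainMap_single, labelChain, labelChain, Finsupp.linearCombination_single]
    refine Eq.trans ?_ (Finsupp.linearCombination_single R (1 : R) y).symm
    refine congrArg (fun f => (1 : R) • S.wedge R f) (funext fun i => ?_)
    exact congrArg A.label (startEdge_sub Q i y).symm
  exact LinearMap.congr_fun this z

theorem homologyLanguage_sub_le (A : HDA.{u, v} S) (Q : A.cubes.Subset)
    (h : A.init ∈ Q.carrier 0) (n : ℕ) :
    (A.sub Q h).homologyLanguage R n ≤ A.homologyLanguage R n := by
  intro t ht
  obtain ⟨z, hz, rfl⟩ := (mem_homologyLanguage R).1 ht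
  exact (mem_homologyLanguage R).2
    ⟨_, (Q.chainMap_mem_chainCycles R).2 hz, A.labelChain_chainMap R Q h n z⟩

/-- Labels vanish on boundaries, so a cycle may be replaced by a homologous one supported in `Q`. -/
theorem homologyLanguage_le_sub (A : HDA.{u, v} S) (Q : A.cubes.Subset)
    (h : A.init ∈ Q.carrier 0) (m : ℕ)
    (hQ : ∀ z ∈ A.cubes.chainCycles R m, ∃ w, ∀ y ∉ Q.carrier m,
      (z - A.cubes.chainBoundary R m w) y = 0) :
    A.homologyLanguage R m ≤ (A.sub Q h).homologyLanguage R m := by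
  intro t ht
  obtain ⟨z, hz, rfl⟩ := (mem_homologyLanguage R).1 ht
  obtain ⟨w, hw⟩ := hQ z hz
  obtain ⟨b, hb⟩ := Q.exists_chainMap_eq R hw
  refine (mem_homologyLanguage R).2 ⟨b, ?_, ?_⟩
  · refine (Q.chainMap_mem_chainCycles R).1 ?_
    rw [hb]
    exact sub_mem hz (A.cubes.chainBoundary_mem_chainCycles R m w)
  · rw [← labelChain_chainMap, hb, map_sub, sub_eq_self]
    exact LinearMap.congr_fun (A.labelChain_comp_chainBoundary R m) w

end Homology

end HDA

end

/-! ### The weak equivalence -/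

open PrecubicalSet HDA in
theorem mainTheorem5 (R : Type w) [CommRing R] [IsDomain R] [IsPrincipalIdealRing R]
    (S : ConcurrentAlphabet.{v}) (A : HDA.{u, v} S)
    (n : ℕ) (hn : 2 ≤ n) (x : A.cubes.cube n) (hx : PrecubicalSet.IsRegular x)
    (k : Fin n → Fin 2) (hk0 : ∃ i, k i = 0) (hk1 : ∃ i, k i = 1)
    (hinit : A.cubes.corner k x ≠ A.init)
    (hfinal : A.cubes.corner k x ∉ A.final)
    (hstar : ∀ m : ℕ, PrecubicalSet.star (A.cubes.corner k x) m ⊆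
      Set.range ((PrecubicalSet.sharpHom x).app m)) :
    HDA.WeaklyEquivalent R A (A.removeStar (A.cubes.corner k x) hinit) := by
  have hcorner := corner_eq_sharp A.cubes k x
  -- The edge of x through v in direction `i` has v as its end of sign `k i`; by regularity its
  -- other end survives the removal.
  have hedge : ∀ l, (∃ i, k i = l) → ∃ e, A.cubes.face l 0 e = A.cubes.corner k x ∧
      A.cubes.corner k x ≠ A.cubes.face l.rev 0 e := by
    rintro _ ⟨i, rfl⟩
    obtain ⟨c, hc⟩ := CubeCell.exists_edge k i
    have he : A.cubes.face (k i) 0 (sharp c A.cubes x) = A.cubes.corner k x := by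
      rw [hcorner, ← sharp_face, hc]
    refine ⟨sharp c A.cubes x, he, fun h => ?_⟩
    rw [← he, ← sharp_face, ← sharp_face] at h
    have h' := hx 0 h
    generalize k i = l at h'
    obtain rfl | rfl : l = 0 ∨ l = 1 := by omega
    · exact CubeCell.face_zero_ne_face_one c 0 h'
    · exact CubeCell.face_zero_ne_face_one c 0 h'.symm
  obtain ⟨f, hf, hf'⟩ := hedge 0 hk0
  obtain ⟨e, he, he'⟩ := hedge 1 hk1
  generalize hv : A.cubes.corner k x = v at *
  have vert : ∀ b : (A.removeStar v hinit).cubes.cube 0, v ≠ b.1 := fun b h =>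
    b.2 (mem_star_zero.2 h.symm)
  have reroute : ∀ {a b : (A.removeStar v hinit).cubes.cube 0} {t : S.TraceMonoid},
      A.Reach a.1 b.1 t → (A.removeStar v hinit).Reach a b t := fun {a b t} h =>
    h.removeStar hx hinit (hstar 1) (vert a) (vert b)
  refine ⟨⟨?_, ?_, ?_, ?_, ?_⟩, ⟨?_, ?_, ?_, ?_, ?_⟩⟩
  · rw [accessible_iff, accessible_iff]
    intro h b
    by_cases hb : v = b
    -- The vertex v is reached through the edge `e`, whose start lies in the complement.
    · obtain ⟨t, ht⟩ := h ⟨_, mem_starCompl_zero he'⟩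
      exact ⟨_, ht.of_sub.snoc e rfl (he.trans hb)⟩
    · obtain ⟨t, ht⟩ := h ⟨_, mem_starCompl_zero hb⟩
      exact ⟨t, ht.of_sub⟩
  · rw [coaccessible_iff, coaccessible_iff]
    intro h a
    by_cases ha : v = a
    · obtain ⟨b, hb, t, ht⟩ := h ⟨_, mem_starCompl_zero hf'⟩
      exact ⟨b.1, hb, _, ((Reach.refl (A := A)).snoc f (hf.trans ha) rfl).trans ht.of_sub⟩
    · obtain ⟨b, hb, t, ht⟩ := h ⟨_, mem_starCompl_zero ha⟩
      exact ⟨b.1, hb, t, ht.of_sub⟩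
  · intro t ht
    exact mem_fundamentalMonoid.2 (reroute (mem_fundamentalMonoid.1 ht))
  · intro t ht
    obtain ⟨b, t', h⟩ := mem_traceLanguage.1 ht
    by_cases hb : v = b
    -- A path ending in v is prolonged by `f` before rerouting; this only lengthens the part
    -- discarded when taking prefixes.
    · refine mem_traceLanguage.2 ⟨⟨_, mem_starCompl_zero hf'⟩, t' * S.trace (A.label f), ?_⟩
      rw [← mul_assoc]
      exact reroute (h.snoc f (hf.trans hb) rfl)
    · exact mem_traceLanguage.2 ⟨⟨b, mem_starCompl_zero hb⟩, t', reroute h⟩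
  · intro m
    refine homologyLanguage_le_sub R A _ _ m fun z hz => ?_
    cases n with
    | zero => omega
    | succ n =>
      obtain ⟨w, hw⟩ := exists_sub_boundary_apply_eq_zero R hx (k 0) z
      subst hcorner
      exact ⟨w, fun y hy => apply_eq_zero_of_mem_star R hx k hstar
        (sub_mem hz (A.cubes.chainBoundary_mem_chainCycles R m w)) hw (not_not.1 hy)⟩
  · rw [accessible_iff, accessible_iff]
    intro h b
    obtain ⟨t, ht⟩ := h b.1
    exact ⟨t, reroute ht⟩
  · rw [coaccessible_iff, coaccessible_iff]
    intro h a
    obtain ⟨b, hb, t, ht⟩ := h a.1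
    exact ⟨⟨b, mem_starCompl_zero fun h => hfinal (h ▸ hb)⟩, hb, t, reroute ht⟩
  · intro t ht
    exact mem_fundamentalMonoid.2 (mem_fundamentalMonoid.1 ht).of_sub
  · intro t ht
    obtain ⟨b, t', h⟩ := mem_traceLanguage.1 ht
    exact mem_traceLanguage.2 ⟨b.1, t', h.of_sub⟩
  · exact homologyLanguage_sub_le R A _ _
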